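/- Let $d\ge 1$, let $\Omega\subset\mathbb R^d$ be a bounded domain whose boundary $\partial\Omega$ is a real analytic hypersurface, and let $\Omega_0\subset\Omega$ be an arbitrary subdomain. Let $a>0$, $b\in\mathbb R\setminus\{0\}$, $0<T_1<T_2\le T$, and $g(t)=e^{-\gamma t}$, where $\gamma\in\mathbb C$ satisfies $\gamma\ne (a+ib)\lambda_n$ for every eigenvalue $\lambda_n$ of the operator $-\Delta$ on $L^2(\Omega)$ with domain $H^2(\Omega)\cap H_0^1(\Omega)$. All function spaces are complex-valued. For $j=1,2$ and $\varphi_j\in C_0^\infty(\Omega_0)$ (extended by zero to $\Omega$) let $v_j\in H^1(0,T_j;L^2(\Omega))\cap L^2(0,T_j;H^2(\Omega)\cap H^1_0(\Omega))$ be the solution of the backward problem $$\partial_t v_j+(a+ib)\Delta v_j=0 \ \text{ in }\Omega\times(0,T_j),\qquad v_j=0\ \text{ on }\partial\Omega\times(0,T_j),\qquad v_j(\cdot,T_j)=\varphi_j\ \text{ in }\Omega ,$$ and for $f\in L^2(\Omega)$ put $$\|f\|_{\mathcal B}:=\sup_{\substack{\varphi_1,\varphi_2\in C_0^\infty(\Omega_0)\\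 \|\varphi_1\|_{L^2(\Omega_0)}=\|\varphi_2\|_{L^2(\Omega_0)}=1}}\ \sum_{j=1}^2\left|\int_\Omega\int_0^{T_j} g(t)\,v_j(x,t)\,f(x)\,dt\,dx\right| .$$ Let $u_0\in H^2(\Omega)\cap H_0^1(\Omega)$ and $f_1,f_2\in L^2(\Omega)$, and for $k=1,2$ let $u_k\in H^1(0,T;L^2(\Omega))\cap L^2(0,T;H^2(\Omega)\cap H_0^1(\Omega))$ be the solution of $$\partial_t u_k-(a+ib)\Delta u_k=g(t)f_k(x)\ \text{ in }\Omega\times(0,T],\qquad u_k=0\ \text{ on }\partial\Omega\times(0,T],\qquad u_k(\cdot,0)=u_0\ \text{ in }\Omega .$$ Then $$\|f_1-f_2\|_{\mathcal B}\le\sum_{j=1}^2\|u_1(\cdot,T_j)-u_2(\cdot,T_j)\|_{L^2(\Omega_0)} .$$ In particular $\|f_1-f_2\|_{\mathcal B}$ is finite. -/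

import Mathlib

open MeasureTheory Set Filter Topology TopologicalSpace
open scoped ENNReal Distributions ContDiff

namespace CGL

noncomputable section

/-- The Euclidean space `ℝᵈ`. -/
abbrev E (d : ℕ) : Type := EuclideanSpace ℝ (Fin d)

/-- The complex space `L²(Ω)` with respect to Lebesgue measure. -/
abbrev L2 {d : ℕ} (Ω : Opens (E d)) : Type := Lp ℂ 2 (volume.restrict (Ω : Set (E d)))

/-- The boundary of `Ω` is a real analytic hypersurface: near each boundary point `Ω` is the
sublevel set `{ρ < 0}` of a real analytic function `ρ` with non-vanishing differential there. -/
def HasAnalyticBoundary {d : ℕ} (Ω : Opens (E d)) : Prop :=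
  ∀ x₀ ∈ frontier (Ω : Set (E d)), ∃ (U : Set (E d)) (ρ : E d → ℝ),
    IsOpen U ∧ x₀ ∈ U ∧ AnalyticOnNhd ℝ ρ U ∧ fderiv ℝ ρ x₀ ≠ 0 ∧
      (Ω : Set (E d)) ∩ U = {x ∈ U | ρ x < 0}

/-- The classical partial derivative `∂ᵢ ψ`. -/
def partialDeriv {d : ℕ} (i : Fin d) (ψ : E d → ℂ) (x : E d) : ℂ :=
  fderiv ℝ ψ x (EuclideanSpace.single i 1)

/-- `w'` is the weak partial derivative `∂ᵢ w` in `Ω` (both functions in `L²(Ω)`). -/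
def IsWeakPartial {d : ℕ} (Ω : Opens (E d)) (i : Fin d) (w w' : L2 Ω) : Prop :=
  ∀ ψ : 𝓓(Ω, ℂ),
    ∫ x in (Ω : Set (E d)), w x * partialDeriv i ψ x = - ∫ x in (Ω : Set (E d)), w' x * ψ x

/-- `w ∈ H₀¹(Ω)` with weak gradient `G`: some sequence in `C₀^∞(Ω)` converges to `w` in `L²(Ω)`
while its gradients converge to `G` in `L²(Ω)`, i.e. it converges to `w` in `H¹(Ω)`. -/
def IsH10WithGrad {d : ℕ} (Ω : Opens (E d)) (w : L2 Ω) (G : Fin d → L2 Ω) : Prop :=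
  (∀ i, IsWeakPartial Ω i w (G i)) ∧
  ∃ ψ : ℕ → 𝓓(Ω, ℂ),
    Tendsto (fun n => eLpNorm (fun x => w x - ψ n x) 2 (volume.restrict (Ω : Set (E d))))
      atTop (𝓝 0) ∧
    ∀ i, Tendsto (fun n => eLpNorm (fun x => G i x - partialDeriv i (ψ n) x) 2
      (volume.restrict (Ω : Set (E d)))) atTop (𝓝 0)

/-- `w ∈ H²(Ω) ∩ H₀¹(Ω)` with weak gradient `G` and weak Hessian `H`. -/
def IsH2H10With {d : ℕ} (Ω : Opens (E d)) (w : L2 Ω) (G : Fin d → L2 Ω)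
    (H : Fin d → Fin d → L2 Ω) : Prop :=
  IsH10WithGrad Ω w G ∧ ∀ i j, IsWeakPartial Ω j (G i) (H i j)

/-- `w ∈ H²(Ω) ∩ H₀¹(Ω)`. -/
def MemH2H10 {d : ℕ} (Ω : Opens (E d)) (w : L2 Ω) : Prop :=
  ∃ G H, IsH2H10With Ω w G H

/-- `lam` is an eigenvalue of `-Δ` with domain `H²(Ω) ∩ H₀¹(Ω)`. -/
def IsDirichletEigenvalue {d : ℕ} (Ω : Opens (E d)) (lam : ℝ) : Prop :=
  ∃ w : L2 Ω, w ≠ 0 ∧ ∃ G H, IsH2H10With Ω w G H ∧ - ∑ i, H i i = (lam : ℂ) • w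

/-- `u'` is the weak derivative on `(0,T)` of the `L²(Ω)`-valued function `u`. -/
def IsWeakTimeDeriv {d : ℕ} (Ω : Opens (E d)) (T : ℝ) (u u' : ℝ → L2 Ω) : Prop :=
  ∀ η : 𝓓((⟨Ioo 0 T, isOpen_Ioo⟩ : Opens ℝ), ℂ),
    ∫ t in Ioo 0 T, deriv η t • u t = - ∫ t in Ioo 0 T, η t • u' t

/-- `u ∈ H¹(0,T; L²(Ω)) ∩ L²(0,T; H²(Ω) ∩ H₀¹(Ω))` with `∂ₜ u = u'` and `Δ u = lap`. Here `u` is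
the representative continuous on `[0,T]` with values in `L²(Ω)`, so `u t` is meaningful for every
`t ∈ [0,T]`. Membership in `L²(0,T; H²(Ω))` is square integrability over `(0,T)` of `u` and of all
its weak spatial derivatives up to order two, as functions of `t` with values in `L²(Ω)`. -/
structure IsRegular {d : ℕ} (Ω : Opens (E d)) (T : ℝ) (u u' lap : ℝ → L2 Ω) : Prop where
  continuousOn : ContinuousOn u (Icc 0 T)
  memLp : MemLp u 2 (volume.restrict (Ioo 0 T))
  memLp_deriv : MemLp u' 2 (volume.restrict (Ioo 0 T))
  weakDeriv : IsWeakTimeDeriv Ω T u u'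
  spatial : ∃ (G : Fin d → ℝ → L2 Ω) (H : Fin d → Fin d → ℝ → L2 Ω),
    (∀ i, MemLp (G i) 2 (volume.restrict (Ioo 0 T))) ∧
    (∀ i j, MemLp (H i j) 2 (volume.restrict (Ioo 0 T))) ∧
    (∀ᵐ t ∂(volume.restrict (Ioo 0 T)),
      IsH2H10With Ω (u t) (fun i => G i t) (fun i j => H i j t) ∧ lap t = ∑ i, H i i t)

/-- The temporal profile `g(t) = exp(-γ t)` of the source. -/
def g (γ : ℂ) (t : ℝ) : ℂ := Complex.exp (-γ * t)

/-- `u` is the (strong) solution on `(0,T)` of `∂ₜ u - (a+ib) Δ u = g(t) f(x)` with `u = 0` on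
`∂Ω` and `u(0) = u₀`. -/
def IsSolution {d : ℕ} (Ω : Opens (E d)) (a b : ℝ) (γ : ℂ) (T : ℝ) (u₀ f : L2 Ω)
    (u : ℝ → L2 Ω) : Prop :=
  ∃ u' lap : ℝ → L2 Ω, IsRegular Ω T u u' lap ∧
    (∀ᵐ t ∂(volume.restrict (Ioo 0 T)), u' t - ((a : ℂ) + b * Complex.I) • lap t = g γ t • f) ∧
    u 0 = u₀

/-- `v` is the (strong) solution on `(0,T)` of the backward problem `∂ₜ v + (a+ib) Δ v = 0` with
`v = 0` on `∂Ω` and terminal value `v(T) = φ`. -/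
def IsDualSolution {d : ℕ} (Ω : Opens (E d)) (a b : ℝ) (T : ℝ) (φ : E d → ℂ)
    (v : ℝ → L2 Ω) : Prop :=
  ∃ v' lap : ℝ → L2 Ω, IsRegular Ω T v v' lap ∧
    (∀ᵐ t ∂(volume.restrict (Ioo 0 T)), v' t + ((a : ℂ) + b * Complex.I) • lap t = 0) ∧
    v T =ᵐ[volume.restrict (Ω : Set (E d))] φ

/-- `∫_Ω ∫_0^T g(t) v(x,t) f(x) dt dx`, with the inner integral taken in `L²(Ω)`. -/
def dualPairing {d : ℕ} (Ω : Opens (E d)) (γ : ℂ) (T : ℝ) (v : ℝ → L2 Ω) (f : L2 Ω) : ℂ :=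
  ∫ x in (Ω : Set (E d)), (∫ t in (0 : ℝ)..T, g γ t • v t : L2 Ω) x * f x

/-- The variational norm `‖f‖_B` (valued in `[0,∞]`): the supremum of
`∑ⱼ |∫_Ω ∫_0^{τⱼ} g(t) vⱼ(x,t) f(x) dt dx|` over all `φⱼ ∈ C₀^∞(Ω₀)` with `‖φⱼ‖_{L²(Ω₀)} = 1`,
where `vⱼ` solves the backward problem on `(0,τⱼ)` with terminal value `φⱼ`. -/
def normB {d : ℕ} (Ω Ω₀ : Opens (E d)) (a b : ℝ) (γ : ℂ) (τ : Fin 2 → ℝ) (f : L2 Ω) : ℝ≥0∞ :=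
  sSup {r : ℝ≥0∞ | ∃ (φ : Fin 2 → 𝓓(Ω₀, ℂ)) (v : Fin 2 → ℝ → L2 Ω),
    (∀ j, eLpNorm (φ j) 2 (volume.restrict (Ω₀ : Set (E d))) = 1) ∧
    (∀ j, IsDualSolution Ω a b (τ j) (φ j) (v j)) ∧
    r = ∑ j, ‖dualPairing Ω γ (τ j) (v j) f‖ₑ}

end

end CGL

/-! The proof is a duality argument. For a forward solution `u` and a backward solution `v`, the
function `t ↦ ∫_Ω u v` has derivative `g ∫_Ω f v`: the two Laplacian terms carry `a + ib` with
opposite signs and cancel, since the Dirichlet Laplacian is symmetric for the pairing without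
complex conjugation. Integrating over `(0, τ j)` gives `pairing_solution_dualSolution`. Subtracting
this identity for `u₁` and `u₂` removes the common `u₀`, so the dual pairing of `f₁ - f₂` equals the
pairing of `(u₁ - u₂)(τ j)` with `φ j`. As `φ j` is supported in `Ω₀` with unit norm, Cauchy-Schwarz
(`enorm_pairing_le`) gives the bound.

The work lies in differentiating `∫_Ω u v` when the time derivatives are only weak.
`IsRegular.eq_add_integral` turns them into primitives, and `integral_bilinear_deriv_eq_sub` is the
matching product rule. -/

/-! ### Absolute continuity and the vector-valued product rule -/

section AbsolutelyContinuous

variable {F G H : Type*} [NormedAddCommGroup F] [NormedSpace ℝ F] [NormedAddCommGroup G]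
  [NormedSpace ℝ G] [NormedAddCommGroup H] [NormedSpace ℝ H]

/-- A bounded bilinear map applied to two absolutely continuous functions is absolutely
continuous. -/
theorem AbsolutelyContinuousOnInterval.bilinear (B : F →L[ℝ] G →L[ℝ] H) {f : ℝ → F} {g : ℝ → G}
    {a b : ℝ} (hf : AbsolutelyContinuousOnInterval f a b)
    (hg : AbsolutelyContinuousOnInterval g a b) :
    AbsolutelyContinuousOnInterval (fun t => B (f t) (g t)) a b := by
  obtain ⟨C, hC⟩ := hf.exists_bound
  obtain ⟨D, hD⟩ := hg.exists_bound
  unfold AbsolutelyContinuousOnInterval at hf hg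
  apply squeeze_zero' ?_ ?_
    (by simpa using (hg.const_mul (‖B‖ * C)).add (hf.const_mul (‖B‖ * D)))
  · exact Eventually.of_forall fun t ↦ Finset.sum_nonneg (fun i _ ↦ dist_nonneg)
  rw [eventually_inf_principal]
  filter_upwards with (n, I) hnI
  simp only [Finset.mul_sum, ← Finset.sum_add_distrib]
  gcongr with i hi
  have hI := hnI.1 i hi
  have h₁ := hC _ hI.1
  have h₂ := hD _ hI.2
  rw [dist_eq_norm, dist_eq_norm, dist_eq_norm]
  set x := (I i).1
  set y := (I i).2
  have key : B (f x) (g x) - B (f y) (g y) = B (f x) (g x - g y) + B (f x - f y) (g y) := by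
    simp
  rw [key]
  calc _ ≤ ‖B‖ * ‖f x‖ * ‖g x - g y‖ + ‖B‖ * ‖f x - f y‖ * ‖g y‖ :=
        (norm_add_le _ _).trans (add_le_add (B.le_opNorm₂ _ _) (B.le_opNorm₂ _ _))
    _ ≤ ‖B‖ * C * ‖g x - g y‖ + ‖B‖ * ‖f x - f y‖ * D := by gcongr
    _ = _ := by ring

/-- The primitive of a vector valued integrable function is absolutely continuous. -/
theorem IntervalIntegrable.absolutelyContinuousOnInterval_primitive {f : ℝ → F} {a b c : ℝ}
    (h : IntervalIntegrable f volume a b) (hc : c ∈ uIcc a b) :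
    AbsolutelyContinuousOnInterval (fun x ↦ ∫ v in c..x, f v) a b := by
  have hn := h.norm.absolutelyContinuousOnInterval_intervalIntegral hc
  unfold AbsolutelyContinuousOnInterval at hn ⊢
  refine squeeze_zero' (Eventually.of_forall fun t ↦ Finset.sum_nonneg (fun i _ ↦ dist_nonneg))
    ?_ hn
  rw [eventually_inf_principal]
  filter_upwards with (n, I) hnI
  gcongr with i hi
  have hI := hnI.1 i hi
  have hsub : ∀ {x y : ℝ}, x ∈ uIcc a b → y ∈ uIcc a b → IntervalIntegrable f volume x y :=
    fun hx hy => h.mono_set (uIcc_subset_uIcc hx hy)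
  rw [dist_comm, dist_comm (∫ v in c..(I i).1, ‖f v‖), dist_eq_norm, dist_eq_norm,
    intervalIntegral.integral_interval_sub_left (hsub hc hI.2) (hsub hc hI.1),
    intervalIntegral.integral_interval_sub_left (hsub hc hI.2).norm (hsub hc hI.1).norm]
  exact intervalIntegral.norm_integral_le_abs_integral_norm

/-- A bounded bilinear map applied to an integrable and a continuous function is integrable. -/
theorem IntervalIntegrable.bilinear_continuousOn (B : F →L[ℝ] G →L[ℝ] H) {f : ℝ → F} {g : ℝ → G}
    {a b : ℝ} (hf : IntervalIntegrable f volume a b) (hg : ContinuousOn g (uIcc a b)) :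
    IntervalIntegrable (fun t => B (f t) (g t)) volume a b := by
  obtain ⟨C, hC⟩ := isCompact_uIcc.exists_bound_of_continuousOn hg
  rw [intervalIntegrable_iff] at hf ⊢
  have hgm : AEStronglyMeasurable g (volume.restrict (uIoc a b)) :=
    (hg.mono uIoc_subset_uIcc).aestronglyMeasurable measurableSet_uIoc
  refine (hf.norm.const_mul (‖B‖ * C)).mono'
    (B.aestronglyMeasurable_comp₂ hf.aestronglyMeasurable hgm) ?_
  filter_upwards [ae_restrict_mem measurableSet_uIoc] with t ht
  calc ‖B (f t) (g t)‖ ≤ ‖B‖ * ‖f t‖ * ‖g t‖ := B.le_opNorm₂ _ _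
    _ ≤ ‖B‖ * ‖f t‖ * C := by
      gcongr
      exact hC t (uIoc_subset_uIcc ht)
    _ = ‖B‖ * C * ‖f t‖ := by ring

/-- The product rule, in integrated form, for a bounded bilinear map applied to two primitives. -/
theorem integral_bilinear_deriv_eq_sub [CompleteSpace F] [CompleteSpace G] [CompleteSpace H]
    (B : F →L[ℝ] G →L[ℝ] H) {f f' : ℝ → F} {g g' : ℝ → G} {a b : ℝ}
    (hf' : IntervalIntegrable f' volume a b) (hg' : IntervalIntegrable g' volume a b)
    (hf : ∀ t ∈ uIcc a b, f t = f a + ∫ s in a..t, f' s)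
    (hg : ∀ t ∈ uIcc a b, g t = g a + ∫ s in a..t, g' s) :
    ∫ t in a..b, (B (f' t) (g t) + B (f t) (g' t)) = B (f b) (g b) - B (f a) (g a) := by
  have ha : a ∈ uIcc a b := left_mem_uIcc
  have hb : b ∈ uIcc a b := right_mem_uIcc
  -- Nothing is known of `f` and `g` outside the interval, so two-sided derivatives are taken of the
  -- primitives `P` and `Q`, which agree with them on it.
  obtain ⟨P, hP⟩ : ∃ P : ℝ → F, P = (fun _ => f a) + fun t => ∫ s in a..t, f' s := ⟨_, rfl⟩
  obtain ⟨Q, hQ⟩ : ∃ Q : ℝ → G, Q = (fun _ => g a) + fun t => ∫ s in a..t, g' s := ⟨_, rfl⟩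
  have hfP : ∀ t ∈ uIcc a b, f t = P t := fun t ht => by rw [hf t ht, hP]; rfl
  have hgQ : ∀ t ∈ uIcc a b, g t = Q t := fun t ht => by rw [hg t ht, hQ]; rfl
  have hPac : AbsolutelyContinuousOnInterval P a b := hP ▸
    (contDiffOn_const (c := f a)).absolutelyContinuousOnInterval.add
      (hf'.absolutelyContinuousOnInterval_primitive ha)
  have hQac : AbsolutelyContinuousOnInterval Q a b := hQ ▸
    (contDiffOn_const (c := g a)).absolutelyContinuousOnInterval.add
      (hg'.absolutelyContinuousOnInterval_primitive ha)
  have hPd : ∀ᵐ t, t ∈ uIcc a b → HasDerivAt P (f' t) t := by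
    filter_upwards [hf'.ae_hasDerivAt_integral] with t h ht
    rw [hP]
    exact (h ht a ha).const_add _
  have hQd : ∀ᵐ t, t ∈ uIcc a b → HasDerivAt Q (g' t) t := by
    filter_upwards [hg'.ae_hasDerivAt_integral] with t h ht
    rw [hQ]
    exact (h ht a ha).const_add _
  obtain ⟨D, hD⟩ : ∃ D : ℝ → H, D = fun t => B (P t) (g' t) + B (f' t) (Q t) := ⟨_, rfl⟩
  have hint : IntervalIntegrable D volume a b := hD ▸
    (hg'.bilinear_continuousOn B.flip hPac.continuousOn).add
      (hf'.bilinear_continuousOn B hQac.continuousOn)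
  -- `B (P t) (Q t)` minus the primitive of its a.e. derivative `D` is absolutely continuous with
  -- derivative zero a.e., hence constant.
  have hAC := (hPac.bilinear B hQac).sub (hint.absolutelyContinuousOnInterval_primitive ha)
  obtain ⟨C, hC⟩ := hAC.const_of_ae_hasDerivAt_zero (by
    filter_upwards [hPd, hQd, hint.ae_hasDerivAt_integral] with t h₁ h₂ h₃ ht
    refine ((B.hasDerivAt_of_bilinear (fun _ => h₁ ht) fun _ => h₂ ht).sub
      (h₃ ht a ha)).congr_deriv ?_
    simp only [hD, sub_self])
  have e₁ := hC a ha
  have e₂ := hC b hb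
  simp only [Pi.sub_apply, intervalIntegral.integral_same, sub_zero] at e₁ e₂
  rw [hfP b hb, hgQ b hb, hfP a ha, hgQ a ha, e₁, ← e₂, sub_sub_cancel, hD]
  refine intervalIntegral.integral_congr fun t ht => ?_
  simp only [hfP t ht, hgQ t ht, add_comm]

end AbsolutelyContinuous

/-! ### Weak derivatives on an interval -/

section WeakDerivative

variable {F : Type*} [NormedAddCommGroup F] [NormedSpace ℝ F] [CompleteSpace F]

/-- A smooth function with integral zero and compact support in `(a,b)` is the derivative of such
a function. -/
theorem exists_primitive_of_integral_eq_zero {a b : ℝ} {ψ : ℝ → ℝ} (hψ : ContDiff ℝ ∞ ψ)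
    (hc : HasCompactSupport ψ) (hs : tsupport ψ ⊆ Ioo a b) (h0 : ∫ t, ψ t = 0) :
    ∃ η : ℝ → ℝ, ContDiff ℝ ∞ η ∧ HasCompactSupport η ∧ tsupport η ⊆ Ioo a b ∧ deriv η = ψ := by
  rcases (tsupport ψ).eq_empty_or_nonempty with he | hne
  · have : ψ = 0 := by
      ext t
      exact image_eq_zero_of_notMem_tsupport (by simp [he])
    refine ⟨0, contDiff_zero_fun, .zero, by simp, ?_⟩
    rw [this]
    ext t
    simp
  obtain ⟨α, hα, hαl⟩ := hc.isCompact.exists_isLeast hne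
  obtain ⟨β, hβ, hβl⟩ := hc.isCompact.exists_isGreatest hne
  have hz : ∀ t, t ∉ Icc α β → ψ t = 0 := fun t ht =>
    image_eq_zero_of_notMem_tsupport fun h => ht ⟨hαl h, hβl h⟩
  have hd : ∀ t, HasDerivAt (fun t => ∫ s in a..t, ψ s) (ψ t) t := fun t =>
    hψ.continuous.integral_hasStrictDerivAt a t |>.hasDerivAt
  have hder : deriv (fun t => ∫ s in a..t, ψ s) = ψ := funext fun t => (hd t).deriv
  have hsupp : tsupport (fun t => ∫ s in a..t, ψ s) ⊆ Icc α β := by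
    refine closure_minimal (fun t ht => ?_) isClosed_Icc
    by_contra hnot
    apply ht
    have haα := (hs hα).1
    rcases lt_or_ge t α with hlt | hge
    · refine intervalIntegral.integral_zero_ae (Eventually.of_forall fun s hsm => hz s ?_)
      intro hsI
      have := (uIoc_subset_uIcc hsm).2
      have := max_lt haα hlt
      have := hsI.1
      grind
    · have hβt : β < t := by
        by_contra h
        exact hnot ⟨hge, not_lt.mp h⟩
      simp only
      rw [intervalIntegral.integral_eq_integral_of_support_subset, h0]
      intro s hsm
      have hsI : s ∈ Icc α β := by
        by_contra h
        exact hsm (hz s h)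
      exact ⟨haα.trans_le hsI.1, hsI.2.trans hβt.le⟩
  refine ⟨fun t => ∫ s in a..t, ψ s, ?_, ?_, ?_, hder⟩
  · rw [contDiff_infty_iff_deriv, hder]
    exact ⟨fun t => (hd t).differentiableAt, hψ⟩
  · exact isCompact_Icc.of_isClosed_subset (isClosed_tsupport _) hsupp
  · exact hsupp.trans (Icc_subset_Ioo (hs hα).1 (hs hβ).2)

/-- There is a smooth function with integral one and compact support in `(a,b)`. -/
theorem exists_contDiff_integral_eq_one {a b : ℝ} (hab : a < b) :
    ∃ r : ℝ → ℝ, ContDiff ℝ ∞ r ∧ HasCompactSupport r ∧ ∫ t, r t = 1 ∧ tsupport r ⊆ Ioo a b := by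
  have hr : 0 < (b - a) / 8 := by linarith
  let ρ : ContDiffBump ((a + b) / 2) := ⟨(b - a) / 8, (b - a) / 4, hr, by linarith⟩
  refine ⟨ρ.normed volume, ρ.contDiff_normed, ρ.hasCompactSupport_normed, ρ.integral_normed, ?_⟩
  rw [ρ.tsupport_normed_eq, Real.closedBall_eq_Icc]
  apply Icc_subset_Ioo <;> simp only [ρ] <;> linarith

/-- The lemma of du Bois-Reymond: a function on an interval with vanishing weak derivative is
almost everywhere constant. -/
theorem ae_eq_const_of_integral_deriv_smul_eq_zero {a b : ℝ} (hab : a < b) {p : ℝ → F}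
    (hp : IntegrableOn p (Ioo a b))
    (h : ∀ η : ℝ → ℝ, ContDiff ℝ ∞ η → HasCompactSupport η → tsupport η ⊆ Ioo a b →
      ∫ t in Ioo a b, deriv η t • p t = 0) :
    ∃ c : F, ∀ᵐ t, t ∈ Ioo a b → p t = c := by
  obtain ⟨r, hrs, hrc, hr1, hrt⟩ := exists_contDiff_integral_eq_one hab
  have hsm : ∀ {ψ : ℝ → ℝ}, Continuous ψ → HasCompactSupport ψ →
      IntegrableOn (fun t => ψ t • p t) (Ioo a b) := by
    intro ψ h₁ h₂
    obtain ⟨C, hC⟩ := h₁.bounded_above_of_compact_support h₂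
    exact hp.bdd_smul C h₁.aestronglyMeasurable (Eventually.of_forall hC)
  obtain ⟨c, hc⟩ : ∃ c, c = ∫ t in Ioo a b, r t • p t := ⟨_, rfl⟩
  refine ⟨c, ?_⟩
  have hri : Integrable r := hrs.continuous.integrable_of_hasCompactSupport hrc
  suffices key : ∀ᵐ t, t ∈ Ioo a b → p t - c = 0 by
    filter_upwards [key] with t ht hm
    exact sub_eq_zero.mp (ht hm)
  refine isOpen_Ioo.ae_eq_zero_of_integral_contDiff_smul_eq_zero
    (hp.sub (integrableOn_const (by simp))).locallyIntegrableOn fun ψ hψ hψc hψs => ?_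
  have hψi : Integrable ψ := hψ.continuous.integrable_of_hasCompactSupport hψc
  -- Subtracting `m r` leaves a test function of integral zero, hence the derivative of an
  -- admissible `η`; the hypothesis then gives `∫ ψ p = m c`.
  obtain ⟨m, hm⟩ : ∃ m, m = ∫ t, ψ t := ⟨_, rfl⟩
  have hmc : HasCompactSupport (fun t => m * r t) := hrc.mul_left (f := fun _ => m)
  have hms : ContDiff ℝ ∞ (fun t => m * r t) := contDiff_const.mul hrs
  have hmt : tsupport (fun t => m * r t) ⊆ Ioo a b :=
    (tsupport_mul_subset_right (f := fun _ => m)).trans hrt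
  obtain ⟨η, h₁, h₂, h₃, h₄⟩ := exists_primitive_of_integral_eq_zero (a := a) (b := b)
    (ψ := ψ - fun t => m * r t) (hψ.sub hms) (hψc.sub hmc)
    ((tsupport_sub _ _).trans (union_subset hψs hmt))
    (by
      simp only [Pi.sub_apply]
      rw [integral_sub hψi (hri.const_mul m), integral_const_mul, hr1, mul_one, hm, sub_self])
  have h5 : ∫ t in Ioo a b, ψ t • p t = m • c := by
    have h5 := h η h₁ h₂ h₃
    rw [h₄] at h5
    simp only [Pi.sub_apply, sub_smul] at h5
    rw [integral_sub (hsm hψ.continuous hψc) (hsm hms.continuous hmc), sub_eq_zero] at h5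
    simp only [mul_smul] at h5
    rw [h5, integral_smul, hc]
  have h6 : ∫ t, ψ t • (p t - c) = ∫ t in Ioo a b, ψ t • (p t - c) := by
    rw [setIntegral_eq_integral_of_forall_compl_eq_zero]
    intro t ht
    rw [image_eq_zero_of_notMem_tsupport fun hh => ht (hψs hh), zero_smul]
  have h7 : ∫ t in Ioo a b, ψ t = m := by
    rw [setIntegral_eq_integral_of_forall_compl_eq_zero, hm]
    intro t ht
    exact image_eq_zero_of_notMem_tsupport fun hh => ht (hψs hh)
  rw [h6]
  simp only [smul_sub]
  rw [integral_sub (hsm hψ.continuous hψc) (hψi.integrableOn.smul_const c), h5,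
    integral_smul_const, h7, sub_self]

end WeakDerivative

/-! ### The bilinear pairing and regularity in time -/

namespace CGL

noncomputable section

variable {d : ℕ} {Ω Ω₀ : Opens (E d)}

/-- The bilinear pairing `(w, v) ↦ ∫_Ω w v` on `L²(Ω)`. -/
def pairing (Ω : Opens (E d)) : L2 Ω →L[ℂ] L2 Ω →L[ℂ] ℂ :=
  (ContinuousLinearMap.mul ℂ ℂ).lpPairing (volume.restrict (Ω : Set (E d))) 2 2

theorem pairing_apply (w v : L2 Ω) :
    pairing Ω w v = ∫ x in (Ω : Set (E d)), w x * v x :=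
  ContinuousLinearMap.lpPairing_eq_integral _ _ _

theorem pairing_comm (w v : L2 Ω) : pairing Ω w v = pairing Ω v w := by
  simp only [pairing_apply, mul_comm]

/-- A strong solution is the primitive of its weak time derivative. -/
theorem IsRegular.eq_add_integral {T : ℝ} (hT : 0 < T) {u u' lap : ℝ → L2 Ω}
    (h : IsRegular Ω T u u' lap) :
    IntervalIntegrable u' volume 0 T ∧ ∀ t ∈ Icc 0 T, u t = u 0 + ∫ s in 0..t, u' s := by
  have hu : IntegrableOn u (Ioo 0 T) := h.memLp.integrable one_le_two
  have hu' : IntegrableOn u' (Ioo 0 T) := h.memLp_deriv.integrable one_le_two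
  have hi : IntervalIntegrable u' volume 0 T :=
    (intervalIntegrable_iff_integrableOn_Ioo_of_le hT.le).mpr hu'
  refine ⟨hi, ?_⟩
  obtain ⟨P, hP⟩ : ∃ P : ℝ → L2 Ω, P = fun t => ∫ s in 0..t, u' s := ⟨_, rfl⟩
  have hPc : ContinuousOn P (Icc 0 T) := by
    rw [hP, ← uIcc_of_le hT.le]
    exact (hi.absolutelyContinuousOnInterval_primitive left_mem_uIcc).continuousOn
  have hPi : IntegrableOn P (Ioo 0 T) :=
    (hPc.integrableOn_compact isCompact_Icc).mono_set Ioo_subset_Icc_self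
  have hP0 : P 0 = 0 := by simp [hP]
  -- `u - P` has zero weak derivative: `u` has weak derivative `u'` by hypothesis, and `P` by the
  -- product rule with `η 0 = η T = 0`.
  obtain ⟨c, hc⟩ := ae_eq_const_of_integral_deriv_smul_eq_zero hT (hu.sub hPi) (by
    intro η hη hηc hηs
    have hη' : ∀ t, HasDerivAt η (deriv η t) t := fun t =>
      (hη.differentiable (by simp) t).hasDerivAt
    have hdc : Continuous (deriv η) := hη.continuous_deriv (by simp)
    have h0 : η 0 = 0 := image_eq_zero_of_notMem_tsupport fun hm => (hηs hm).1.false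
    have h1 : η T = 0 := image_eq_zero_of_notMem_tsupport fun hm => (hηs hm).2.false
    have hsupp : tsupport (fun t => (η t : ℂ)) ⊆ tsupport η :=
      closure_mono fun t ht hz => ht (by simp [hz])
    let θ : 𝓓((⟨Ioo 0 T, isOpen_Ioo⟩ : Opens ℝ), ℂ) :=
      ⟨fun t => (η t : ℂ), Complex.ofRealCLM.contDiff.comp hη,
        hηc.of_isClosed_subset (isClosed_tsupport _) hsupp, hsupp.trans hηs⟩
    have hw := h.weakDeriv θ
    have hθ : deriv θ = fun t => ((deriv η t : ℝ) : ℂ) :=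
      funext fun t => (hη' t).ofReal_comp.deriv
    rw [hθ] at hw
    change _ = - ∫ t in Ioo 0 T, (η t : ℂ) • u' t at hw
    simp only [Complex.coe_smul] at hw
    have hprod := integral_bilinear_deriv_eq_sub (ContinuousLinearMap.lsmul ℝ ℝ)
      (f := η) (f' := deriv η) (g := P) (g' := u') (hdc.intervalIntegrable 0 T) hi
      (fun t _ => by
        rw [intervalIntegral.integral_eq_sub_of_hasDerivAt (fun x _ => hη' x)
          (hdc.intervalIntegrable 0 t)]
        ring)
      (fun t _ => by rw [hP0, zero_add, hP])
    simp only [ContinuousLinearMap.lsmul_apply, h0, h1, zero_smul, sub_zero] at hprod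
    obtain ⟨C, hC⟩ := hη.continuous.bounded_above_of_compact_support hηc
    obtain ⟨D, hD⟩ := hdc.bounded_above_of_compact_support hηc.deriv
    have hbd : ∀ {p : ℝ → L2 Ω}, IntegrableOn p (Ioo 0 T) →
        IntegrableOn (fun t => deriv η t • p t) (Ioo 0 T) := fun hp =>
      hp.bdd_smul D hdc.aestronglyMeasurable (Eventually.of_forall hD)
    have hηu' : IntegrableOn (fun t => η t • u' t) (Ioo 0 T) :=
      hu'.bdd_smul C hη.continuous.aestronglyMeasurable (Eventually.of_forall hC)
    rw [intervalIntegral.integral_of_le hT.le, integral_Ioc_eq_integral_Ioo,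
      integral_add (hbd hPi) hηu'] at hprod
    simp only [Pi.sub_apply, smul_sub]
    rw [integral_sub (hbd hu) (hbd hPi)]
    exact sub_eq_zero.mpr (hw.trans (eq_neg_of_add_eq_zero_left hprod).symm))
  -- Continuity upgrades a.e. equality to equality everywhere on `[0,T]`, endpoints included; the
  -- initial and terminal values depend on this.
  have hEq : EqOn (u - P) (fun _ => c) (Icc 0 T) := by
    refine Measure.eqOn_Icc_of_ae_eq volume hT.ne ?_ (h.continuousOn.sub hPc) continuousOn_const
    rw [← Measure.restrict_congr_set Ioo_ae_eq_Icc]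
    exact (ae_restrict_iff' measurableSet_Ioo).mpr hc
  have hc0 : u 0 = c := by
    have := hEq (left_mem_Icc.mpr hT.le)
    rwa [Pi.sub_apply, hP0, sub_zero] at this
  intro t ht
  have := hEq ht
  rw [Pi.sub_apply, sub_eq_iff_eq_add] at this
  rw [this, hc0, hP]

/-! ### Green's identity -/

theorem memLp_testFunction (ψ : 𝓓(Ω, ℂ)) : MemLp ψ 2 (volume.restrict (Ω : Set (E d))) :=
  (ψ.continuous.memLp_of_hasCompactSupport ψ.hasCompactSupport).restrict _

theorem memLp_partialDeriv (i : Fin d) (ψ : 𝓓(Ω, ℂ)) :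
    MemLp (partialDeriv i ψ) 2 (volume.restrict (Ω : Set (E d))) := by
  have hc : Continuous (partialDeriv i ψ) :=
    (ψ.contDiff.continuous_fderiv (by simp)).clm_apply continuous_const
  exact (hc.memLp_of_hasCompactSupport (ψ.hasCompactSupport.fderiv_apply ℝ _)).restrict _

/-- The integral of `w` against an `L²`-limit is the limit of the integrals. -/
theorem tendsto_integral_mul {w v : L2 Ω} {q : ℕ → E d → ℂ}
    (hq : ∀ n, MemLp (q n) 2 (volume.restrict (Ω : Set (E d))))
    (h : Tendsto (fun n => eLpNorm (fun x => v x - q n x) 2 (volume.restrict (Ω : Set (E d))))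
      atTop (𝓝 0)) :
    Tendsto (fun n => ∫ x in (Ω : Set (E d)), w x * q n x) atTop (𝓝 (pairing Ω w v)) := by
  have hL : Tendsto (fun n => (hq n).toLp (q n)) atTop (𝓝 v) := by
    rw [Lp.tendsto_Lp_iff_tendsto_eLpNorm']
    refine h.congr fun n => ?_
    rw [← eLpNorm_neg]
    refine eLpNorm_congr_ae ?_
    filter_upwards [(hq n).coeFn_toLp] with x hx
    simp [hx]
  refine (((pairing Ω w).continuous.tendsto v).comp hL).congr fun n => ?_
  rw [Function.comp_apply, pairing_apply]
  refine integral_congr_ae ?_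
  filter_upwards [(hq n).coeFn_toLp] with x hx
  rw [hx]

/-- Integration by parts against a function in `H₀¹(Ω)`. -/
theorem IsWeakPartial.pairing_eq {i : Fin d} {w w' v : L2 Ω} {K : Fin d → L2 Ω}
    (hw : IsWeakPartial Ω i w w') (hv : IsH10WithGrad Ω v K) :
    pairing Ω w (K i) = - pairing Ω w' v := by
  obtain ⟨-, ψ, h₁, h₂⟩ := hv
  -- Both sides of the weak-derivative identity for the approximating `ψ n` converge, and their
  -- limits must agree.
  refine tendsto_nhds_unique
    (tendsto_integral_mul (fun n => memLp_partialDeriv i (ψ n)) (h₂ i)) ?_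
  refine (tendsto_integral_mul (w := w') (fun n => memLp_testFunction (ψ n)) h₁).neg.congr
    fun n => ?_
  exact (hw (ψ n)).symm

/-- Green's first identity. -/
theorem pairing_laplacian {w v : L2 Ω} {G K : Fin d → L2 Ω} {H : Fin d → Fin d → L2 Ω}
    (hw : IsH2H10With Ω w G H) (hv : IsH10WithGrad Ω v K) :
    pairing Ω (∑ i, H i i) v = - ∑ i, pairing Ω (G i) (K i) := by
  rw [map_sum, sum_apply, ← Finset.sum_neg_distrib]
  exact Finset.sum_congr rfl fun i _ => by rw [(hw.2 i i).pairing_eq hv, neg_neg]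

/-- The Dirichlet Laplacian is symmetric for the bilinear pairing. -/
theorem pairing_laplacian_comm {w v : L2 Ω} {G K : Fin d → L2 Ω} {H L : Fin d → Fin d → L2 Ω}
    (hw : IsH2H10With Ω w G H) (hv : IsH2H10With Ω v K L) :
    pairing Ω (∑ i, H i i) v = pairing Ω w (∑ i, L i i) := by
  rw [pairing_laplacian hw hv.1, pairing_comm w, pairing_laplacian hv hw.1]
  simp only [pairing_comm]

/-! ### Duality and the final estimate -/

theorem continuous_g (γ : ℂ) : Continuous (g γ) := by
  unfold g
  fun_prop

theorem dualPairing_eq_pairing (γ : ℂ) (T : ℝ) (v : ℝ → L2 Ω) (f : L2 Ω) :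
    dualPairing Ω γ T v f = pairing Ω (∫ t in (0 : ℝ)..T, g γ t • v t) f :=
  (pairing_apply _ _).symm

theorem dualPairing_sub (γ : ℂ) (T : ℝ) (v : ℝ → L2 Ω) (f₁ f₂ : L2 Ω) :
    dualPairing Ω γ T v (f₁ - f₂) = dualPairing Ω γ T v f₁ - dualPairing Ω γ T v f₂ := by
  simp only [dualPairing_eq_pairing, map_sub]

/-- Duality between the forward and the backward problem. -/
theorem pairing_solution_dualSolution {a b : ℝ} {γ : ℂ} {T S : ℝ} (hS : 0 < S) (hST : S ≤ T)
    {u₀ f : L2 Ω} {u v : ℝ → L2 Ω} {φ : E d → ℂ} (hu : IsSolution Ω a b γ T u₀ f u)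
    (hv : IsDualSolution Ω a b S φ v) :
    pairing Ω (u S) (v S) = pairing Ω u₀ (v 0) + dualPairing Ω γ S v f := by
  obtain ⟨u', lu, hur, hue, rfl⟩ := hu
  obtain ⟨v', lv, hvr, hve, -⟩ := hv
  obtain ⟨hui, huP⟩ := hur.eq_add_integral (hS.trans_le hST)
  obtain ⟨hvi, hvP⟩ := hvr.eq_add_integral hS
  have hsub : Icc 0 S ⊆ Icc 0 T := Icc_subset_Icc_right hST
  have key := integral_bilinear_deriv_eq_sub ((pairing Ω).bilinearRestrictScalars ℝ)
    (f := u) (f' := u') (g := v) (g' := v') (a := 0) (b := S)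
    (hui.mono_set (by simpa [uIcc_of_le hS.le, uIcc_of_le (hS.le.trans hST)] using hsub)) hvi
    (fun t ht => huP t (hsub (by rwa [uIcc_of_le hS.le] at ht)))
    (fun t ht => hvP t (by rwa [uIcc_of_le hS.le] at ht))
  simp only [ContinuousLinearMap.bilinearRestrictScalars_apply_apply] at key
  have hgv : IntervalIntegrable (fun t => g γ t • v t) volume 0 S := by
    apply ContinuousOn.intervalIntegrable
    rw [uIcc_of_le hS.le]
    exact (continuous_g γ).continuousOn.smul hvr.continuousOn
  have hdual : dualPairing Ω γ S v f = ∫ t in 0..S, (pairing Ω).flip f (g γ t • v t) := by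
    rw [dualPairing_eq_pairing, ContinuousLinearMap.intervalIntegral_comp_comm _ hgv]
    rfl
  rw [hdual, ← sub_eq_iff_eq_add', ← key, intervalIntegral.integral_of_le hS.le,
    intervalIntegral.integral_of_le hS.le, integral_Ioc_eq_integral_Ioo,
    integral_Ioc_eq_integral_Ioo]
  obtain ⟨G, H, -, -, hGH⟩ := hur.spatial
  obtain ⟨K, L, -, -, hKL⟩ := hvr.spatial
  have hmono : volume.restrict (Ioo 0 S) ≤ volume.restrict (Ioo 0 T) :=
    Measure.restrict_mono (Ioo_subset_Ioo_right hST) le_rfl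
  refine integral_congr_ae ?_
  filter_upwards [ae_mono hmono hue, hve, ae_mono hmono hGH, hKL] with t h₁ h₂ h₃ h₄
  -- Symmetry makes the terms `±(a+ib)` cancel, leaving only the source.
  have hgreen := pairing_laplacian_comm h₃.1 h₄.1
  rw [← h₃.2, ← h₄.2] at hgreen
  rw [sub_eq_iff_eq_add.mp h₁, eq_neg_of_add_eq_zero_left h₂]
  simp only [map_add, map_neg, map_smul, add_apply,
    smul_apply, ContinuousLinearMap.flip_apply, hgreen, pairing_comm f]
  ring

/-- Pairing with a function supported in `Ω₀` only sees the values in `Ω₀`. -/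
theorem enorm_pairing_le (hsub : Ω₀ ≤ Ω) {w v : L2 Ω} (φ : 𝓓(Ω₀, ℂ))
    (hv : v =ᵐ[volume.restrict (Ω : Set (E d))] φ) :
    ‖pairing Ω w v‖ₑ ≤ eLpNorm w 2 (volume.restrict (Ω₀ : Set (E d))) *
      eLpNorm φ 2 (volume.restrict (Ω₀ : Set (E d))) := by
  have hle : volume.restrict (Ω₀ : Set (E d)) ≤ volume.restrict (Ω : Set (E d)) :=
    Measure.restrict_mono hsub le_rfl
  have h₁ : pairing Ω w v = ∫ x in (Ω₀ : Set (E d)), w x * φ x := by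
    have h₀ : pairing Ω w v = ∫ x in (Ω : Set (E d)), w x * φ x := by
      rw [pairing_apply]
      refine integral_congr_ae ?_
      filter_upwards [hv] with x hx
      rw [hx]
    rw [h₀]
    refine setIntegral_eq_of_subset_of_forall_sdiff_eq_zero Ω.isOpen.measurableSet hsub
      fun x hx => ?_
    rw [image_eq_zero_of_notMem_tsupport fun hm => hx.2 (φ.tsupport_subset hm), mul_zero]
  have h₂ : eLpNorm ((w : E d → ℂ) • (φ : E d → ℂ)) 1 (volume.restrict (Ω₀ : Set (E d))) ≤
      eLpNorm w 2 (volume.restrict (Ω₀ : Set (E d))) *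
      eLpNorm φ 2 (volume.restrict (Ω₀ : Set (E d))) :=
    eLpNorm_smul_le_mul_eLpNorm φ.continuous.aestronglyMeasurable
      ((Lp.aestronglyMeasurable w).mono_measure hle)
  rw [h₁]
  refine (enorm_integral_le_lintegral_enorm _).trans ?_
  rwa [eLpNorm_one_eq_lintegral_enorm] at h₂

end

end CGL

theorem theorem1p3 {d : ℕ} (hd : 1 ≤ d)
    (Ω Ω₀ : TopologicalSpace.Opens (CGL.E d))
    (hΩ : IsConnected (Ω : Set (CGL.E d)))
    (hΩb : Bornology.IsBounded (Ω : Set (CGL.E d)))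
    (hΩa : CGL.HasAnalyticBoundary Ω)
    (hΩ₀ : IsConnected (Ω₀ : Set (CGL.E d))) (hsub : Ω₀ ≤ Ω)
    (a b : ℝ) (ha : 0 < a) (hb : b ≠ 0)
    (γ : ℂ) (hγ : ∀ lam : ℝ, CGL.IsDirichletEigenvalue Ω lam → γ ≠ ((a : ℂ) + b * Complex.I) * lam)
    (T : ℝ) (τ : Fin 2 → ℝ) (hτ0 : 0 < τ 0) (hτ : τ 0 < τ 1) (hτT : τ 1 ≤ T)
    (u₀ : CGL.L2 Ω) (hu₀ : CGL.MemH2H10 Ω u₀)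
    (f₁ f₂ : CGL.L2 Ω) (u₁ u₂ : ℝ → CGL.L2 Ω)
    (hu₁ : CGL.IsSolution Ω a b γ T u₀ f₁ u₁)
    (hu₂ : CGL.IsSolution Ω a b γ T u₀ f₂ u₂) :
    CGL.normB Ω Ω₀ a b γ τ (f₁ - f₂) ≤
      ∑ j, eLpNorm (fun x => u₁ (τ j) x - u₂ (τ j) x) 2
        (volume.restrict (Ω₀ : Set (CGL.E d))) := by
  refine sSup_le ?_
  rintro r ⟨φ, v, hφ, hv, rfl⟩
  refine Finset.sum_le_sum fun j _ => ?_
  have hpos : 0 < τ j ∧ τ j ≤ T := by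
    fin_cases j
    · exact ⟨hτ0, hτ.le.trans hτT⟩
    · exact ⟨hτ0.trans hτ, hτT⟩
  have h₁ := CGL.pairing_solution_dualSolution hpos.1 hpos.2 hu₁ (hv j)
  have h₂ := CGL.pairing_solution_dualSolution hpos.1 hpos.2 hu₂ (hv j)
  -- The term `pairing Ω u₀ (v j 0)` occurs in both `h₁` and `h₂` and drops out.
  have hdiff : CGL.dualPairing Ω γ (τ j) (v j) (f₁ - f₂) =
      CGL.pairing Ω (u₁ (τ j) - u₂ (τ j)) (v j (τ j)) := by
    rw [CGL.dualPairing_sub, map_sub, sub_apply, h₁, h₂]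
    ring
  have hle : volume.restrict (Ω₀ : Set (CGL.E d)) ≤ volume.restrict (Ω : Set (CGL.E d)) :=
    Measure.restrict_mono hsub le_rfl
  obtain ⟨_, _, _, _, hφv⟩ := hv j
  rw [hdiff]
  refine (CGL.enorm_pairing_le hsub (φ j) hφv).trans_eq ?_
  rw [hφ j, mul_one]
  exact eLpNorm_congr_ae (ae_mono hle (Lp.coeFn_sub _ _))
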